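/- Let $N\ge 1$, $p>1$, $0<s<1$, and let $\Omega\subset\mathbb{R}^N$ be a bounded open set. Put $$[u]_{s,p}=\Big(\int_{\mathbb{R}^{2N}}\frac{|u(x)-u(y)|^p}{|x-y|^{N+sp}}\,dx\,dy\Big)^{1/p},\qquad W_0^{s,p}(\Omega)=\{u\in L^p(\mathbb{R}^N):\ [u]_{s,p}<\infty,\ u=0\text{ a.e. in }\mathbb{R}^N\setminus\Omega\},$$ where $W_0^{s,p}(\Omega)$ is normed by $[\cdot]_{s,p}$, and for $u,v\in W_0^{s,p}(\Omega)$ set $$\langle(-\Delta)_p^su,v\rangle=\int_{\mathbb{R}^{2N}}\frac{|u(x)-u(y)|^{p-2}(u(x)-u(y))(v(x)-v(y))}{|x-y|^{N+sp}}\,dx\,dy.$$ For a function $g$ on $\Omega$, $g\in W_0^{s,p}(\Omega)^*$ means that there is a constant $C$ such that for all $v\in W_0^{s,p}(\Omega)$ one has $gv\in L^1(\Omega)$ and $|\int_\Omega gv\,dx|\le C[v]_{s,p}$. Let $g\in W_0^{s,p}(\Omega)^*\cap L^1(\Omega)$ and let $u\in W_0^{s,p}(\Omega)$ be a weak solution of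 $(-\Delta)_p^su=g$ in $\Omega$, $u=0$ in $\mathbb{R}^N\setminus\Omega$, that is, $\langle(-\Delta)_p^su,v\rangle=\int_\Omega gv\,dx$ for all $v\in W_0^{s,p}(\Omega)$ with $v\ge 0$ a.e. Let $\Psi\in C^2(\mathbb{R})$ be convex and Lipschitz with $\Psi(0)=0$. Suppose in addition that either $\Psi''\in L^\infty(\mathbb{R})$ or $g$ has a constant sign ($g\ge 0$ a.e. in $\Omega$, or $g\le 0$ a.e. in $\Omega$). Then $\Psi(u)\in W_0^{s,p}(\Omega)$, and for all $\psi\in W_0^{s,p}(\Omega)\cap L^\infty(\Omega)$ with $\psi\ge 0$ a.e., $$\langle(-\Delta)_p^s\Psi(u),\psi\rangle\le\int_\Omega|\Psi'(u)|^{p-2}\Psi'(u)\,g\,\psi\,dx,$$ where both integrals converge absolutely and $|t|^{p-2}t$ is read as $0$ at $t=0$. -/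

import Mathlib

open MeasureTheory

namespace FracPLap

/-- The Gagliardo energy, i.e. the `p`-th power of the Gagliardo seminorm, as an extended
nonnegative number: the integral over `ℝᴺ × ℝᴺ` of `|u x - u y| ^ p / |x - y| ^ (N + s p)`. -/
noncomputable def gagliardoEnergy {N : ℕ} (s p : ℝ) (u : EuclideanSpace ℝ (Fin N) → ℝ) : ENNReal :=
  ∫⁻ z : EuclideanSpace ℝ (Fin N) × EuclideanSpace ℝ (Fin N),
    ENNReal.ofReal (|u z.1 - u z.2| ^ p / ‖z.1 - z.2‖ ^ ((N : ℝ) + s * p))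

/-- The Gagliardo seminorm `[u]_{s,p}` (meaningful when the energy is finite). -/
noncomputable def gagliardoSeminorm {N : ℕ} (s p : ℝ) (u : EuclideanSpace ℝ (Fin N) → ℝ) : ℝ :=
  (gagliardoEnergy s p u).toReal ^ (1 / p)

/-- `u ∈ W^{s,p}(ℝᴺ)`: `u` is in `Lᵖ(ℝᴺ)` and its Gagliardo seminorm is finite. -/
structure MemW {N : ℕ} (s p : ℝ) (u : EuclideanSpace ℝ (Fin N) → ℝ) : Prop where
  memLp : MemLp u (ENNReal.ofReal p) volume
  energy_lt_top : gagliardoEnergy s p u < ⊤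

/-- `u ∈ W_0^{s,p}(Ω)`: `u ∈ W^{s,p}(ℝᴺ)` and `u = 0` a.e. outside `Ω`. -/
structure MemW0 {N : ℕ} (s p : ℝ) (Ω : Set (EuclideanSpace ℝ (Fin N)))
    (u : EuclideanSpace ℝ (Fin N) → ℝ) : Prop where
  memW : MemW s p u
  ae_eq_zero : ∀ᵐ x : EuclideanSpace ℝ (Fin N), x ∉ Ω → u x = 0

/-- `J_w(x, y) = |w x - w y| ^ (p - 2) (w x - w y)` (equal to `0` where `w x = w y`). -/
noncomputable def J {N : ℕ} (p : ℝ) (w : EuclideanSpace ℝ (Fin N) → ℝ)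
    (x y : EuclideanSpace ℝ (Fin N)) : ℝ :=
  |w x - w y| ^ (p - 2) * (w x - w y)

/-- The integrand of the weak form of the fractional `p`-Laplacian. -/
noncomputable def pairingIntegrand {N : ℕ} (s p : ℝ) (u v : EuclideanSpace ℝ (Fin N) → ℝ)
    (z : EuclideanSpace ℝ (Fin N) × EuclideanSpace ℝ (Fin N)) : ℝ :=
  J p u z.1 z.2 * (v z.1 - v z.2) / ‖z.1 - z.2‖ ^ ((N : ℝ) + s * p)

/-- The pairing `⟨(-Δ)_p^s u, v⟩`, an integral over `ℝᴺ × ℝᴺ`. -/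
noncomputable def pairing {N : ℕ} (s p : ℝ) (u v : EuclideanSpace ℝ (Fin N) → ℝ) : ℝ :=
  ∫ z : EuclideanSpace ℝ (Fin N) × EuclideanSpace ℝ (Fin N), pairingIntegrand s p u v z

/-- `g ∈ W_0^{s,p}(Ω)^*`: for every `v ∈ W_0^{s,p}(Ω)` the product `g v` is integrable on `Ω`, and
`v ↦ ∫_Ω g v` is bounded with respect to the norm `[v]_{s,p}` of `W_0^{s,p}(Ω)`. -/
def MemDual {N : ℕ} (s p : ℝ) (Ω : Set (EuclideanSpace ℝ (Fin N)))
    (g : EuclideanSpace ℝ (Fin N) → ℝ) : Prop :=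
  ∃ C : ℝ, ∀ v : EuclideanSpace ℝ (Fin N) → ℝ, MemW0 s p Ω v →
    IntegrableOn (fun x => g x * v x) Ω volume ∧
      |∫ x in Ω, g x * v x| ≤ C * gagliardoSeminorm s p v

/-- `u` is a weak solution of `(-Δ)_p^s u = g` in `Ω`, `u = 0` in `ℝᴺ \ Ω`. -/
structure IsWeakSolution {N : ℕ} (s p : ℝ) (Ω : Set (EuclideanSpace ℝ (Fin N)))
    (g u : EuclideanSpace ℝ (Fin N) → ℝ) : Prop where
  memW0 : MemW0 s p Ω u
  memDual : MemDual s p Ω g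
  eq_of_nonneg : ∀ v : EuclideanSpace ℝ (Fin N) → ℝ, MemW0 s p Ω v →
    (∀ᵐ x : EuclideanSpace ℝ (Fin N), 0 ≤ v x) →
      pairing s p u v = ∫ x in Ω, g x * v x

end FracPLap

/-!
Write `J_p t = |t| ^ (p - 2) t`, an odd, multiplicative, increasing bijection of `ℝ`. If
`Φ a - Φ b ≤ φ a (a - b)` for all `a, b` (so `Φ` is convex with slope `φ`), then applying `J_p` to this
inequality and to the one with `a, b` exchanged gives, for `A, B ≥ 0`,
`J_p (Φ a - Φ b) (A - B) ≤ J_p (a - b) (A J_p (φ a) - B J_p (φ b))`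
(`signedRpow_slope_inequality`). With `a = u x`, `b = u y`, `A = ψ x`, `B = ψ y` and after integration,
the right-hand side is the equation for `u` tested with `J_p (φ (u)) ψ`. This test function is
admissible when `J_p ∘ φ` is bounded and Lipschitz (`pairing_comp_le_of_lipschitz`); its sign is
irrelevant, since it is a difference of two nonnegative test functions.

For `φ = Ψ'` the function `h = J_p ∘ Ψ'` is bounded, continuous and monotone, but in general not
Lipschitz (`Ψ''` may be unbounded, and `J_p` is not Lipschitz at `0` for `p < 2`). It is therefore
replaced by its averages `h_n t = n ∫_t^{t + 1/n} h`, which are bounded, monotone and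
Lipschitz and tend to `h` pointwise. The slopes `φ_n = J_p⁻¹ ∘ h_n` are again monotone with the
same bound as `Ψ'`, and their primitives `Φ_n` are uniformly Lipschitz, convex, and tend to `Ψ`
pointwise. The inequality for `Φ_n` passes to the limit by dominated convergence: on the left
because of the common Lipschitz constant and the finite energies, on the right because `h_n` and `ψ`
are bounded and `g` is integrable on `Ω`.
-/

open Filter Topology

namespace FracPLap

/-! ### The signed power -/

/-- The signed power `|t| ^ (r - 1) t = sign t |t| ^ r`; its value at `0` is `0` for every `r`. -/
noncomputable def signedRpow (r t : ℝ) : ℝ := |t| ^ (r - 1) * t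

lemma abs_signedRpow {r : ℝ} (hr : 0 < r) (t : ℝ) : |signedRpow r t| = |t| ^ r := by
  unfold signedRpow
  rcases eq_or_ne t 0 with rfl | ht
  · simp [Real.zero_rpow hr.ne']
  · have h : 0 < |t| := abs_pos.2 ht
    rw [abs_mul, abs_of_nonneg (Real.rpow_nonneg h.le _), Real.rpow_sub_one h.ne',
      div_mul_cancel₀ _ h.ne']

lemma signedRpow_mul (r a b : ℝ) : signedRpow r (a * b) = signedRpow r a * signedRpow r b := by
  unfold signedRpow
  rw [abs_mul, Real.mul_rpow (abs_nonneg _) (abs_nonneg _)]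
  ring

lemma signedRpow_neg (r t : ℝ) : signedRpow r (-t) = -signedRpow r t := by
  simp [signedRpow]

/-- Splitting into positive and negative parts makes continuity and monotonicity evident. -/
lemma signedRpow_eq_sub {r : ℝ} (hr : 0 < r) (t : ℝ) :
    signedRpow r t = max t 0 ^ r - max (-t) 0 ^ r := by
  have key : ∀ x : ℝ, 0 ≤ x → signedRpow r x = max x 0 ^ r - max (-x) 0 ^ r := by
    intro x hx
    rw [max_eq_left hx, max_eq_right (neg_nonpos.2 hx), Real.zero_rpow hr.ne', sub_zero]
    have h := abs_signedRpow hr x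
    have h0 : 0 ≤ signedRpow r x := mul_nonneg (Real.rpow_nonneg (abs_nonneg _) _) hx
    rwa [abs_of_nonneg h0, abs_of_nonneg hx] at h
  rcases le_total 0 t with ht | ht
  · exact key t ht
  · have h := key (-t) (neg_nonneg.2 ht)
    rw [signedRpow_neg, neg_neg] at h
    linarith

lemma signedRpow_monotone {r : ℝ} (hr : 0 < r) : Monotone (signedRpow r) := by
  intro a b hab
  rw [signedRpow_eq_sub hr, signedRpow_eq_sub hr]
  have h1 : max a 0 ^ r ≤ max b 0 ^ r := by gcongr
  have h2 : max (-b) 0 ^ r ≤ max (-a) 0 ^ r := by gcongr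
  linarith

lemma continuous_signedRpow {r : ℝ} (hr : 0 < r) : Continuous (signedRpow r) := by
  rw [funext (signedRpow_eq_sub hr)]
  exact ((continuous_id.max continuous_const).rpow_const fun _ => Or.inr hr.le).sub
    ((continuous_neg.max continuous_const).rpow_const fun _ => Or.inr hr.le)

lemma signedRpow_signedRpow_inv {r : ℝ} (hr : 0 < r) (t : ℝ) :
    signedRpow r (signedRpow r⁻¹ t) = t := by
  rcases eq_or_ne t 0 with rfl | ht
  · simp [signedRpow]
  · have h : 0 < |t| := abs_pos.2 ht
    rw [signedRpow, abs_signedRpow (inv_pos.2 hr), signedRpow, ← Real.rpow_mul h.le, ← mul_assoc,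
      ← Real.rpow_add h]
    have : r⁻¹ * (r - 1) + (r⁻¹ - 1) = 0 := by field_simp; ring
    rw [this, Real.rpow_zero, one_mul]

lemma signedRpow_inv_signedRpow {r : ℝ} (hr : 0 < r) (t : ℝ) :
    signedRpow r⁻¹ (signedRpow r t) = t := by
  simpa using signedRpow_signedRpow_inv (inv_pos.2 hr) t

/-- The pointwise inequality behind the result: the hypothesis at `(a, b)` and at `(b, a)`, raised to the
signed power `r`, with weights `A` and `B`. -/
lemma signedRpow_slope_inequality {r : ℝ} (hr : 0 < r) {Φ φ : ℝ → ℝ}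
    (hΦ : ∀ a b, Φ a - Φ b ≤ φ a * (a - b)) (a b : ℝ) {A B : ℝ} (hA : 0 ≤ A) (hB : 0 ≤ B) :
    signedRpow r (Φ a - Φ b) * (A - B) ≤
      signedRpow r (a - b) * (A * signedRpow r (φ a) - B * signedRpow r (φ b)) := by
  have h1 : signedRpow r (Φ a - Φ b) ≤ signedRpow r (φ a) * signedRpow r (a - b) := by
    rw [← signedRpow_mul]
    exact signedRpow_monotone hr (hΦ a b)
  have h2 : signedRpow r (φ b) * signedRpow r (a - b) ≤ signedRpow r (Φ a - Φ b) := by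
    rw [← signedRpow_mul]
    exact signedRpow_monotone hr (by linarith [hΦ b a])
  nlinarith [mul_le_mul_of_nonneg_left h1 hA, mul_le_mul_of_nonneg_left h2 hB]

/-! ### Approximation of bounded monotone functions and of their primitives -/

/-- A bounded continuous monotone function is a pointwise limit of Lipschitz monotone functions
with the same bound, namely of its averages over the intervals `[t, t + 1 / n]`. -/
lemma exists_lipschitz_monotone_approx {h : ℝ → ℝ} (hc : Continuous h) (hm : Monotone h) {C : ℝ}
    (hC : ∀ t, |h t| ≤ C) :
    ∃ H : ℕ → ℝ → ℝ, (∀ n, ∃ K : NNReal, LipschitzWith K (H n)) ∧ (∀ n, Monotone (H n)) ∧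
      (∀ n t, |H n t| ≤ C) ∧ ∀ t, Tendsto (fun n => H n t) atTop (𝓝 (h t)) := by
  have hC0 : 0 ≤ C := (abs_nonneg _).trans (hC 0)
  have hi : ∀ a b : ℝ, IntervalIntegrable h volume a b := fun a b => hc.intervalIntegrable a b
  let F : ℝ → ℝ := fun t => ∫ r in (0 : ℝ)..t, h r
  have hF : ∀ a b, F b - F a = ∫ r in a..b, h r := fun a b =>
    intervalIntegral.integral_interval_sub_left (hi _ _) (hi _ _)
  have hFl : ∀ a b, |F b - F a| ≤ C * |b - a| := fun a b => by
    rw [hF]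
    exact intervalIntegral.norm_integral_le_of_norm_le_const (f := h) fun x _ => hC x
  let δ : ℕ → ℝ := fun n => ((n : ℝ) + 1)⁻¹
  have hδ : ∀ n, 0 < δ n := fun n => by positivity
  refine ⟨fun n t => (δ n)⁻¹ * (F (t + δ n) - F t), fun n => ?_, fun n => ?_, fun n t => ?_,
    fun t => ?_⟩
  · refine ⟨Real.toNNReal ((δ n)⁻¹ * (2 * C)), LipschitzWith.of_dist_le_mul fun a b => ?_⟩
    have hpos : 0 ≤ (δ n)⁻¹ * (2 * C) := mul_nonneg (inv_nonneg.2 (hδ n).le) (by linarith)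
    rw [Real.coe_toNNReal _ hpos, Real.dist_eq, Real.dist_eq, ← mul_sub, abs_mul,
      abs_of_pos (inv_pos.2 (hδ n)), mul_assoc]
    refine mul_le_mul_of_nonneg_left ?_ (inv_nonneg.2 (hδ n).le)
    have h1 := hFl (b + δ n) (a + δ n)
    have h2 := hFl b a
    rw [add_sub_add_right_eq_sub] at h1
    calc |F (a + δ n) - F a - (F (b + δ n) - F b)|
        = |(F (a + δ n) - F (b + δ n)) - (F a - F b)| := by congr 1; ring
      _ ≤ _ := abs_sub _ _
      _ ≤ 2 * C * |a - b| := by linarith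
  · intro a b hab
    refine mul_le_mul_of_nonneg_left ?_ (inv_nonneg.2 (hδ n).le)
    have hshift : ∀ t, F (t + δ n) - F t = ∫ r in (0 : ℝ)..δ n, h (r + t) := fun t => by
      rw [hF, intervalIntegral.integral_comp_add_right, zero_add, add_comm]
    simp only [hshift]
    exact intervalIntegral.integral_mono_on (hδ n).le
      ((hc.comp (continuous_id.add continuous_const)).intervalIntegrable _ _)
      ((hc.comp (continuous_id.add continuous_const)).intervalIntegrable _ _)
      fun x _ => hm (by linarith)
  · have h1 := hFl t (t + δ n)
    rw [add_sub_cancel_left, abs_of_pos (hδ n)] at h1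
    rw [abs_mul, abs_of_pos (inv_pos.2 (hδ n)), inv_mul_le_iff₀ (hδ n)]
    linarith
  · have hd : HasDerivAt F (h t) t :=
      intervalIntegral.integral_hasDerivAt_right (hi _ _) (hc.stronglyMeasurableAtFilter _ _)
        hc.continuousAt
    have hlim : Tendsto δ atTop (𝓝[≠] 0) := by
      refine tendsto_nhdsWithin_iff.2 ⟨?_, Eventually.of_forall fun n => (hδ n).ne'⟩
      simpa [δ, one_div] using tendsto_one_div_add_atTop_nhds_zero_nat (𝕜 := ℝ)
    exact (hasDerivAt_iff_tendsto_slope_zero.1 hd).comp hlim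

/-- A bounded continuous monotone `φ` is a pointwise limit of monotone functions with the same bound
whose signed powers are Lipschitz: the averages are taken of `signedRpow r ∘ φ`, and then mapped
back by the inverse signed power. -/
lemma exists_slope_approx {r : ℝ} (hr : 0 < r) {φ : ℝ → ℝ} (hc : Continuous φ) (hm : Monotone φ)
    {L : ℝ} (hL : ∀ t, |φ t| ≤ L) :
    ∃ f : ℕ → ℝ → ℝ, (∀ n, Continuous (f n)) ∧ (∀ n, Monotone (f n)) ∧ (∀ n t, |f n t| ≤ L) ∧
      (∀ t, Tendsto (fun n => f n t) atTop (𝓝 (φ t))) ∧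
      ∀ n, ∃ K : NNReal, LipschitzWith K fun t => signedRpow r (f n t) := by
  have hr' : 0 < r⁻¹ := inv_pos.2 hr
  have hL0 : 0 ≤ L := (abs_nonneg _).trans (hL 0)
  have hb : ∀ t, |signedRpow r (φ t)| ≤ L ^ r := fun t => by
    rw [abs_signedRpow hr]
    exact Real.rpow_le_rpow (abs_nonneg _) (hL t) hr.le
  obtain ⟨H, hHlip, hHm, hHb, hHlim⟩ := exists_lipschitz_monotone_approx
    ((continuous_signedRpow hr).comp hc) ((signedRpow_monotone hr).comp hm) hb
  refine ⟨fun n t => signedRpow r⁻¹ (H n t), fun n => ?_,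
    fun n => (signedRpow_monotone hr').comp (hHm n), fun n t => ?_, fun t => ?_, fun n => ?_⟩
  · obtain ⟨K, hK⟩ := hHlip n
    exact (continuous_signedRpow hr').comp hK.continuous
  · rw [abs_signedRpow hr', Real.rpow_inv_le_iff_of_pos (abs_nonneg _) hL0 hr]
    exact hHb n t
  · have := ((continuous_signedRpow hr').tendsto _).comp (hHlim t)
    rwa [Function.comp_apply, signedRpow_inv_signedRpow hr] at this
  · simpa only [signedRpow_signedRpow_inv hr] using hHlip n

lemma intervalIntegral_sub_le_slope {φ : ℝ → ℝ} (hc : Continuous φ) (hm : Monotone φ) (a b : ℝ) :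
    (∫ r in (0 : ℝ)..a, φ r) - (∫ r in (0 : ℝ)..b, φ r) ≤ φ a * (a - b) := by
  have hi : ∀ a b : ℝ, IntervalIntegrable φ volume a b := fun a b => hc.intervalIntegrable a b
  rw [intervalIntegral.integral_interval_sub_left (hi _ _) (hi _ _)]
  rcases le_total b a with h | h
  · have := intervalIntegral.integral_mono_on h (hi b a) (_root_.intervalIntegrable_const (c := φ a))
      fun x hx => hm hx.2
    simp only [intervalIntegral.integral_const, smul_eq_mul] at this
    linarith
  · have := intervalIntegral.integral_mono_on h (_root_.intervalIntegrable_const (c := φ a)) (hi a b)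
      fun x hx => hm hx.1
    simp only [intervalIntegral.integral_const, smul_eq_mul] at this
    rw [intervalIntegral.integral_symm]
    linarith

lemma abs_intervalIntegral_sub_le {φ : ℝ → ℝ} (hc : Continuous φ) {L : ℝ} (hL : ∀ t, |φ t| ≤ L)
    (a b : ℝ) :
    |(∫ r in (0 : ℝ)..a, φ r) - (∫ r in (0 : ℝ)..b, φ r)| ≤ L * |a - b| := by
  rw [intervalIntegral.integral_interval_sub_left (hc.intervalIntegrable _ _)
    (hc.intervalIntegrable _ _)]
  exact intervalIntegral.norm_integral_le_of_norm_le_const (f := φ) fun x _ => hL x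

/-! ### Integrability for functions of finite Gagliardo energy -/

variable {N : ℕ} {s p : ℝ}

/-- The Gagliardo kernel `|x - y| ^ (-(N + s p))`, equal to `0` on the diagonal. -/
noncomputable def kernel (N : ℕ) (s p : ℝ)
    (z : EuclideanSpace ℝ (Fin N) × EuclideanSpace ℝ (Fin N)) : ℝ :=
  (‖z.1 - z.2‖ ^ ((N : ℝ) + s * p))⁻¹

lemma kernel_nonneg (z : EuclideanSpace ℝ (Fin N) × EuclideanSpace ℝ (Fin N)) :
    0 ≤ kernel N s p z :=
  inv_nonneg.2 (Real.rpow_nonneg (norm_nonneg _) _)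

lemma measurable_kernel : Measurable (kernel N s p) := by
  unfold kernel
  fun_prop

lemma pairingIntegrand_eq (u v : EuclideanSpace ℝ (Fin N) → ℝ)
    (z : EuclideanSpace ℝ (Fin N) × EuclideanSpace ℝ (Fin N)) :
    pairingIntegrand s p u v z =
      signedRpow (p - 1) (u z.1 - u z.2) * (v z.1 - v z.2) * kernel N s p z := by
  unfold pairingIntegrand J signedRpow kernel
  rw [show p - 1 - 1 = p - 2 by ring, div_eq_mul_inv]

lemma aestronglyMeasurable_sub {u : EuclideanSpace ℝ (Fin N) → ℝ}
    (hu : AEStronglyMeasurable u volume) :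
    AEStronglyMeasurable (fun z : EuclideanSpace ℝ (Fin N) × EuclideanSpace ℝ (Fin N) =>
      u z.1 - u z.2) volume :=
  hu.comp_fst.sub hu.comp_snd

lemma aestronglyMeasurable_energy (hp : 0 ≤ p) {u : EuclideanSpace ℝ (Fin N) → ℝ}
    (hu : AEStronglyMeasurable u volume) :
    AEStronglyMeasurable (fun z : EuclideanSpace ℝ (Fin N) × EuclideanSpace ℝ (Fin N) =>
      |u z.1 - u z.2| ^ p * kernel N s p z) volume :=
  ((Real.continuous_rpow_const hp).comp continuous_abs |>.comp_aestronglyMeasurable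
    (aestronglyMeasurable_sub hu)).mul measurable_kernel.aestronglyMeasurable

lemma gagliardoEnergy_lt_top_iff (hp : 0 ≤ p) {u : EuclideanSpace ℝ (Fin N) → ℝ}
    (hu : AEStronglyMeasurable u volume) :
    gagliardoEnergy s p u < ⊤ ↔
      Integrable (fun z : EuclideanSpace ℝ (Fin N) × EuclideanSpace ℝ (Fin N) =>
        |u z.1 - u z.2| ^ p * kernel N s p z) volume := by
  have hnn : ∀ z : EuclideanSpace ℝ (Fin N) × EuclideanSpace ℝ (Fin N),
      0 ≤ |u z.1 - u z.2| ^ p * kernel N s p z := fun z =>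
    mul_nonneg (Real.rpow_nonneg (abs_nonneg _) _) (kernel_nonneg z)
  rw [Integrable, and_iff_right (aestronglyMeasurable_energy hp hu),
    hasFiniteIntegral_iff_ofReal (Eventually.of_forall hnn)]
  simp only [gagliardoEnergy, kernel, div_eq_mul_inv]

lemma MemW.integrable_energy (hp : 0 ≤ p) {u : EuclideanSpace ℝ (Fin N) → ℝ} (hu : MemW s p u) :
    Integrable (fun z : EuclideanSpace ℝ (Fin N) × EuclideanSpace ℝ (Fin N) =>
      |u z.1 - u z.2| ^ p * kernel N s p z) volume :=
  (gagliardoEnergy_lt_top_iff hp hu.memLp.1).1 hu.energy_lt_top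

/-- A function in `Lᵖ` whose increments are controlled by those of two functions of finite energy
has finite energy. -/
lemma MemW.of_increment_le (hp : 0 ≤ p) {u v w : EuclideanSpace ℝ (Fin N) → ℝ} (hu : MemW s p u)
    (hv : MemW s p v) (hw : MemLp w (ENNReal.ofReal p) volume) {A B : ℝ} (hA : 0 ≤ A) (hB : 0 ≤ B)
    (h : ∀ᵐ z : EuclideanSpace ℝ (Fin N) × EuclideanSpace ℝ (Fin N),
      |w z.1 - w z.2| ≤ A * |u z.1 - u z.2| + B * |v z.1 - v z.2|) : MemW s p w := by
  refine ⟨hw, (gagliardoEnergy_lt_top_iff hp hw.1).2 ?_⟩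
  refine (((hu.integrable_energy hp).const_mul ((2 * A) ^ p)).add
    ((hv.integrable_energy hp).const_mul ((2 * B) ^ p))).mono'
    (aestronglyMeasurable_energy hp hw.1) ?_
  filter_upwards [h] with z hz
  have hk := kernel_nonneg (s := s) (p := p) z
  rw [Real.norm_of_nonneg (mul_nonneg (Real.rpow_nonneg (abs_nonneg _) _) hk), Pi.add_apply,
    ← mul_assoc, ← mul_assoc, ← add_mul]
  refine mul_le_mul_of_nonneg_right ?_ hk
  rw [← Real.mul_rpow (by positivity) (abs_nonneg _), ← Real.mul_rpow (by positivity) (abs_nonneg _)]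
  have ha : 0 ≤ 2 * A * |u z.1 - u z.2| := by positivity
  have hb : 0 ≤ 2 * B * |v z.1 - v z.2| := by positivity
  rcases le_total (2 * A * |u z.1 - u z.2|) (2 * B * |v z.1 - v z.2|) with hab | hab
  · exact (Real.rpow_le_rpow (abs_nonneg _) (by linarith) hp).trans
      (le_add_of_nonneg_left (Real.rpow_nonneg ha _))
  · exact (Real.rpow_le_rpow (abs_nonneg _) (by linarith) hp).trans
      (le_add_of_nonneg_right (Real.rpow_nonneg hb _))

lemma aestronglyMeasurable_pairingIntegrand (hp : 1 < p) {u v : EuclideanSpace ℝ (Fin N) → ℝ}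
    (hu : AEStronglyMeasurable u volume) (hv : AEStronglyMeasurable v volume) :
    AEStronglyMeasurable (pairingIntegrand s p u v) volume := by
  rw [funext (pairingIntegrand_eq u v)]
  exact (((continuous_signedRpow (sub_pos.2 hp)).comp_aestronglyMeasurable
    (aestronglyMeasurable_sub hu)).mul (aestronglyMeasurable_sub hv)).mul
    measurable_kernel.aestronglyMeasurable

/-- A crude form of Young's inequality. -/
lemma rpow_sub_one_mul_le (hp : 1 < p) {a b : ℝ} (ha : 0 ≤ a) (hb : 0 ≤ b) :
    a ^ (p - 1) * b ≤ a ^ p + b ^ p := by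
  have key : ∀ c : ℝ, 0 ≤ c → c ^ (p - 1) * c = c ^ p := fun c hc => by
    rw [← Real.rpow_add_one' hc (by linarith), sub_add_cancel]
  rcases le_total a b with h | h
  · calc a ^ (p - 1) * b ≤ b ^ (p - 1) * b := by
          gcongr
      _ = b ^ p := key b hb
      _ ≤ _ := le_add_of_nonneg_left (Real.rpow_nonneg ha _)
  · calc a ^ (p - 1) * b ≤ a ^ (p - 1) * a := by gcongr
      _ = a ^ p := key a ha
      _ ≤ _ := le_add_of_nonneg_right (Real.rpow_nonneg hb _)

/-- Domination of the pairing of an `L`-Lipschitz image of `u`; the bound depends only on `L`. -/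
lemma norm_pairingIntegrand_comp_le (hp : 1 < p) {u v : EuclideanSpace ℝ (Fin N) → ℝ} {Φ : ℝ → ℝ}
    {L : ℝ} (hΦ : ∀ a b, |Φ a - Φ b| ≤ L * |a - b|) (hL : 0 ≤ L)
    (z : EuclideanSpace ℝ (Fin N) × EuclideanSpace ℝ (Fin N)) :
    ‖pairingIntegrand s p (fun x => Φ (u x)) v z‖ ≤ L ^ (p - 1) *
      (|u z.1 - u z.2| ^ p * kernel N s p z + |v z.1 - v z.2| ^ p * kernel N s p z) := by
  have hk := kernel_nonneg (s := s) (p := p) z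
  rw [pairingIntegrand_eq, norm_mul, Real.norm_of_nonneg hk, ← add_mul, ← mul_assoc, Real.norm_eq_abs,
    abs_mul, abs_signedRpow (sub_pos.2 hp)]
  refine mul_le_mul_of_nonneg_right ?_ hk
  calc |Φ (u z.1) - Φ (u z.2)| ^ (p - 1) * |v z.1 - v z.2|
      ≤ (L * |u z.1 - u z.2|) ^ (p - 1) * |v z.1 - v z.2| := by
        gcongr
        exact hΦ _ _
    _ = L ^ (p - 1) * (|u z.1 - u z.2| ^ (p - 1) * |v z.1 - v z.2|) := by
        rw [Real.mul_rpow hL (abs_nonneg _), mul_assoc]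
    _ ≤ _ := mul_le_mul_of_nonneg_left (rpow_sub_one_mul_le hp (abs_nonneg _) (abs_nonneg _))
        (Real.rpow_nonneg hL _)

lemma integrable_pairingIntegrand (hp : 1 < p) {u v : EuclideanSpace ℝ (Fin N) → ℝ}
    (hu : MemW s p u) (hv : MemW s p v) : Integrable (pairingIntegrand s p u v) volume := by
  have hp0 : 0 ≤ p := by linarith
  refine (((hu.integrable_energy hp0).add (hv.integrable_energy hp0)).const_mul
    ((1 : ℝ) ^ (p - 1))).mono' (aestronglyMeasurable_pairingIntegrand hp hu.memLp.1 hv.memLp.1)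
    (Eventually.of_forall fun z => ?_)
  exact norm_pairingIntegrand_comp_le (Φ := fun t => t) hp (fun a b => by simp) zero_le_one z

lemma pairing_sub (hp : 1 < p) {u v w : EuclideanSpace ℝ (Fin N) → ℝ} (hu : MemW s p u)
    (hv : MemW s p v) (hw : MemW s p w) :
    pairing s p u (fun x => v x - w x) = pairing s p u v - pairing s p u w := by
  unfold pairing
  rw [← integral_sub (integrable_pairingIntegrand hp hu hv) (integrable_pairingIntegrand hp hu hw)]
  congr 1 with z
  simp only [pairingIntegrand]
  ring

/-! ### Admissible compositions and products -/

variable {Ω : Set (EuclideanSpace ℝ (Fin N))}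

lemma MemW0.comp_lipschitz (hp : 0 ≤ p) {u : EuclideanSpace ℝ (Fin N) → ℝ} (hu : MemW0 s p Ω u)
    {Φ : ℝ → ℝ} {L : NNReal} (hΦ : LipschitzWith L Φ) (hΦ0 : Φ 0 = 0) :
    MemW0 s p Ω (fun x => Φ (u x)) := by
  refine ⟨hu.memW.of_increment_le hp hu.memW (hΦ.comp_memLp hΦ0 hu.memW.memLp) L.2 le_rfl
    (Eventually.of_forall fun z => ?_), ?_⟩
  · have := hΦ.dist_le_mul (u z.1) (u z.2)
    rw [Real.dist_eq, Real.dist_eq] at this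
    simpa using this
  · filter_upwards [hu.ae_eq_zero] with x hx hxΩ
    rw [hx hxΩ, hΦ0]

/-- `h(u) ψ` is an admissible test function if `h` is bounded and Lipschitz and `ψ` is bounded. -/
lemma MemW0.comp_mul (hp : 0 ≤ p) {u ψ : EuclideanSpace ℝ (Fin N) → ℝ} (hu : MemW0 s p Ω u)
    (hψ : MemW0 s p Ω ψ) {h : ℝ → ℝ} {K : NNReal} (hK : LipschitzWith K h) {C M : ℝ}
    (hC : ∀ t, |h t| ≤ C) (hM : ∀ᵐ x, |ψ x| ≤ M) :
    MemW0 s p Ω (fun x => h (u x) * ψ x) := by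
  have hmeas : AEStronglyMeasurable (fun x => h (u x)) volume :=
    hK.continuous.comp_aestronglyMeasurable hu.memW.memLp.1
  have hC0 : 0 ≤ C := (abs_nonneg _).trans (hC 0)
  -- replacing `M` by `|M|` avoids deducing `0 ≤ M` from the almost everywhere bound
  refine ⟨hu.memW.of_increment_le hp hψ.memW (A := |M| * K) (B := C) ?_
    (mul_nonneg (abs_nonneg M) K.2) hC0 ?_, ?_⟩
  · refine hψ.memW.memLp.of_le_mul (c := C) (hmeas.mul hψ.memW.memLp.1)
      (Eventually.of_forall fun x => ?_)
    rw [norm_mul]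
    exact mul_le_mul_of_nonneg_right (hC _) (norm_nonneg _)
  · have hM2 : ∀ᵐ z : EuclideanSpace ℝ (Fin N) × EuclideanSpace ℝ (Fin N), |ψ z.2| ≤ M :=
      Measure.quasiMeasurePreserving_snd.ae hM
    filter_upwards [hM2] with z hz
    have h1 := hK.dist_le_mul (u z.1) (u z.2)
    rw [Real.dist_eq, Real.dist_eq] at h1
    calc |h (u z.1) * ψ z.1 - h (u z.2) * ψ z.2|
        = |ψ z.2 * (h (u z.1) - h (u z.2)) + h (u z.1) * (ψ z.1 - ψ z.2)| := by congr 1; ring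
      _ ≤ |ψ z.2| * |h (u z.1) - h (u z.2)| + |h (u z.1)| * |ψ z.1 - ψ z.2| := by
          rw [← abs_mul, ← abs_mul]
          exact abs_add_le _ _
      _ ≤ |M| * (K * |u z.1 - u z.2|) + C * |ψ z.1 - ψ z.2| := by
          exact add_le_add (mul_le_mul (hz.trans (le_abs_self M)) h1 (abs_nonneg _) (abs_nonneg _))
            (mul_le_mul_of_nonneg_right (hC _) (abs_nonneg _))
      _ = _ := by ring
  · filter_upwards [hψ.ae_eq_zero] with x hx hxΩ
    rw [hx hxΩ, mul_zero]

lemma ae_abs_le_of_memLp_top (hΩ : MeasurableSet Ω) {ψ : EuclideanSpace ℝ (Fin N) → ℝ}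
    (hψ : MemW0 s p Ω ψ) (hb : MemLp ψ ⊤ (volume.restrict Ω)) : ∃ M : ℝ, ∀ᵐ x, |ψ x| ≤ M := by
  have hb' := hb.2
  rw [eLpNorm_exponent_top] at hb'
  refine ⟨(eLpNormEssSup ψ (volume.restrict Ω)).toReal, ?_⟩
  filter_upwards [(ae_restrict_iff' hΩ).1 (ae_le_eLpNormEssSup (f := ψ) (μ := volume.restrict Ω)),
    hψ.ae_eq_zero] with x hx hx0
  by_cases hxΩ : x ∈ Ω
  · have h := ENNReal.toReal_mono hb'.ne (hx hxΩ)
    simpa using h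
  · rw [hx0 hxΩ, abs_zero]
    exact ENNReal.toReal_nonneg

/-! ### The inequality for convex functions -/

/-- A function `h(u) ψ` may be used as a test function whatever its sign is, because it is the
difference of the nonnegative functions `(h(u) + C) ψ` and `C ψ`. -/
lemma IsWeakSolution.pairing_comp_mul (hp : 1 < p) {g u ψ : EuclideanSpace ℝ (Fin N) → ℝ}
    (hu : IsWeakSolution s p Ω g u) (hψ : MemW0 s p Ω ψ) (hψ0 : ∀ᵐ x, 0 ≤ ψ x) {h : ℝ → ℝ}
    {K : NNReal} (hK : LipschitzWith K h) {C M : ℝ} (hC : ∀ t, |h t| ≤ C) (hM : ∀ᵐ x, |ψ x| ≤ M) :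
    pairing s p u (fun x => h (u x) * ψ x) = ∫ x in Ω, g x * (h (u x) * ψ x) := by
  have hp0 : 0 ≤ p := by linarith
  have hC0 : 0 ≤ C := (abs_nonneg _).trans (hC 0)
  have h1 : MemW0 s p Ω (fun x => (h (u x) + C) * ψ x) :=
    hu.memW0.comp_mul hp0 hψ (h := fun t => h t + C) (K := K)
      (LipschitzWith.of_dist_le_mul fun a b => by
        simpa using hK.dist_le_mul a b) (C := C + |C|)
      (fun t => (abs_add_le _ _).trans (by linarith [hC t])) hM
  have h2 : MemW0 s p Ω (fun x => C * ψ x) :=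
    hu.memW0.comp_mul hp0 hψ (h := fun _ => C) (LipschitzWith.const C) (C := |C|)
      (fun _ => le_rfl) hM
  have h3 : (fun x => h (u x) * ψ x) = fun x => (h (u x) + C) * ψ x - C * ψ x := by
    ext x
    ring
  obtain ⟨_, hdual⟩ := hu.memDual
  rw [h3, pairing_sub hp hu.memW0.memW h1.memW h2.memW, hu.eq_of_nonneg _ h1, hu.eq_of_nonneg _ h2,
    ← integral_sub (hdual _ h1).1 (hdual _ h2).1]
  · congr 1 with x
    ring
  · filter_upwards [hψ0] with x hx using mul_nonneg hC0 hx
  · filter_upwards [hψ0] with x hx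
    exact mul_nonneg (by linarith [neg_le_of_abs_le (hC (u x))]) hx

/-- The case of a slope `φ` with bounded Lipschitz signed power, where the equation for `u` can be tested
with `J_p (φ (u)) ψ`. -/
lemma pairing_comp_le_of_lipschitz (hp : 1 < p) {g u ψ : EuclideanSpace ℝ (Fin N) → ℝ}
    (hu : IsWeakSolution s p Ω g u) (hψ : MemW0 s p Ω ψ) (hψ0 : ∀ᵐ x, 0 ≤ ψ x) {M : ℝ}
    (hM : ∀ᵐ x, |ψ x| ≤ M) {Φ φ : ℝ → ℝ} (hΦ0 : Φ 0 = 0)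
    (hΦ : ∀ a b, Φ a - Φ b ≤ φ a * (a - b)) {L K : NNReal} (hL : LipschitzWith L Φ)
    (hK : LipschitzWith K fun t => signedRpow (p - 1) (φ t)) {C : ℝ}
    (hC : ∀ t, |signedRpow (p - 1) (φ t)| ≤ C) :
    pairing s p (fun x => Φ (u x)) ψ ≤ ∫ x in Ω, signedRpow (p - 1) (φ (u x)) * g x * ψ x := by
  have hp0 : 0 ≤ p := by linarith
  calc pairing s p (fun x => Φ (u x)) ψ
      ≤ pairing s p u (fun x => signedRpow (p - 1) (φ (u x)) * ψ x) := by
        refine integral_mono_ae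
          (integrable_pairingIntegrand hp (hu.memW0.comp_lipschitz hp0 hL hΦ0).memW hψ.memW)
          (integrable_pairingIntegrand hp hu.memW0.memW
            (hu.memW0.comp_mul hp0 hψ hK hC hM).memW) ?_
        have hfst : ∀ᵐ z : EuclideanSpace ℝ (Fin N) × EuclideanSpace ℝ (Fin N), 0 ≤ ψ z.1 :=
          Measure.quasiMeasurePreserving_fst.ae hψ0
        have hsnd : ∀ᵐ z : EuclideanSpace ℝ (Fin N) × EuclideanSpace ℝ (Fin N), 0 ≤ ψ z.2 :=
          Measure.quasiMeasurePreserving_snd.ae hψ0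
        filter_upwards [hfst, hsnd] with z hz1 hz2
        rw [pairingIntegrand_eq, pairingIntegrand_eq]
        refine mul_le_mul_of_nonneg_right ?_ (kernel_nonneg z)
        have := signedRpow_slope_inequality (sub_pos.2 hp) hΦ (u z.1) (u z.2) hz1 hz2
        linarith
    _ = ∫ x in Ω, g x * (signedRpow (p - 1) (φ (u x)) * ψ x) :=
        hu.pairing_comp_mul hp hψ hψ0 hK hC hM
    _ = _ := by
        congr 1 with x
        ring

lemma integrableOn_comp_mul_mul {g u ψ : EuclideanSpace ℝ (Fin N) → ℝ} (hg : IntegrableOn g Ω volume)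
    (hu : AEStronglyMeasurable u volume) (hψ : AEStronglyMeasurable ψ volume) {M C : ℝ}
    (hM : ∀ᵐ x, |ψ x| ≤ M) {h : ℝ → ℝ} (hc : Continuous h) (hC : ∀ t, |h t| ≤ C) :
    IntegrableOn (fun x => h (u x) * g x * ψ x) Ω volume := by
  have h1 : IntegrableOn (fun x => h (u x) * g x) Ω volume :=
    hg.bdd_mul (c := C) (hc.comp_aestronglyMeasurable hu).restrict
      (Eventually.of_forall fun x => hC (u x))
  exact h1.mul_bdd (c := M) hψ.restrict (ae_restrict_of_ae hM)

lemma tendsto_setIntegral_comp_mul_mul {g u ψ : EuclideanSpace ℝ (Fin N) → ℝ}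
    (hg : IntegrableOn g Ω volume) (hu : AEStronglyMeasurable u volume)
    (hψ : AEStronglyMeasurable ψ volume) {M C : ℝ} (hM : ∀ᵐ x, |ψ x| ≤ M) {H : ℕ → ℝ → ℝ}
    {h : ℝ → ℝ} (hc : ∀ n, Continuous (H n)) (hC : ∀ n t, |H n t| ≤ C)
    (hlim : ∀ t, Tendsto (fun n => H n t) atTop (𝓝 (h t))) :
    Tendsto (fun n => ∫ x in Ω, H n (u x) * g x * ψ x) atTop
      (𝓝 (∫ x in Ω, h (u x) * g x * ψ x)) := by
  refine tendsto_integral_of_dominated_convergence (fun x => C * |g x| * M)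
    (fun n => (integrableOn_comp_mul_mul hg hu hψ hM (hc n) (hC n)).1)
    ((hg.abs.const_mul C).mul_const M) (fun n => ?_)
    (Eventually.of_forall fun x => ((hlim (u x)).mul_const _).mul_const _)
  filter_upwards [ae_restrict_of_ae hM] with x hx
  have hC0 : 0 ≤ C := (abs_nonneg _).trans (hC 0 0)
  rw [norm_mul, norm_mul]
  exact mul_le_mul (mul_le_mul_of_nonneg_right (hC n _) (norm_nonneg _)) hx (norm_nonneg _)
    (by positivity)

lemma tendsto_pairing_comp (hp : 1 < p) {u ψ : EuclideanSpace ℝ (Fin N) → ℝ} (hu : MemW s p u)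
    (hψ : MemW s p ψ) {F : ℕ → ℝ → ℝ} {Φ : ℝ → ℝ} {L : ℝ} (hL0 : 0 ≤ L)
    (hL : ∀ n a b, |F n a - F n b| ≤ L * |a - b|) (hc : ∀ n, Continuous (F n))
    (hlim : ∀ t, Tendsto (fun n => F n t) atTop (𝓝 (Φ t))) :
    Tendsto (fun n => pairing s p (fun x => F n (u x)) ψ) atTop
      (𝓝 (pairing s p (fun x => Φ (u x)) ψ)) := by
  have hp0 : 0 ≤ p := by linarith
  refine tendsto_integral_of_dominated_convergence _
    (fun n => aestronglyMeasurable_pairingIntegrand hp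
      ((hc n).comp_aestronglyMeasurable hu.memLp.1) hψ.memLp.1)
    (((hu.integrable_energy hp0).add (hψ.integrable_energy hp0)).const_mul (L ^ (p - 1)))
    (fun n => Eventually.of_forall fun z => norm_pairingIntegrand_comp_le hp (hL n) hL0 z)
    (Eventually.of_forall fun z => ?_)
  simp only [pairingIntegrand_eq]
  exact ((((continuous_signedRpow (sub_pos.2 hp)).tendsto _).comp
    ((hlim (u z.1)).sub (hlim (u z.2)))).mul_const _).mul_const _

/-- The inequality for the primitive of a bounded continuous monotone function `φ`. -/
lemma pairing_intervalIntegral_comp_le (hp : 1 < p) {g u ψ : EuclideanSpace ℝ (Fin N) → ℝ}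
    (hg : IntegrableOn g Ω volume) (hu : IsWeakSolution s p Ω g u) (hψ : MemW0 s p Ω ψ)
    (hψ0 : ∀ᵐ x, 0 ≤ ψ x) {M : ℝ} (hM : ∀ᵐ x, |ψ x| ≤ M) {φ : ℝ → ℝ} (hc : Continuous φ)
    (hm : Monotone φ) {L : ℝ} (hL : ∀ t, |φ t| ≤ L) :
    pairing s p (fun x => ∫ r in (0 : ℝ)..u x, φ r) ψ ≤
      ∫ x in Ω, signedRpow (p - 1) (φ (u x)) * g x * ψ x := by
  have hr : 0 < p - 1 := sub_pos.2 hp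
  have hL0 : 0 ≤ L := (abs_nonneg _).trans (hL 0)
  obtain ⟨f, hfc, hfm, hfL, hflim, hflip⟩ := exists_slope_approx hr hc hm hL
  have hHb : ∀ n t, |signedRpow (p - 1) (f n t)| ≤ L ^ (p - 1) := fun n t => by
    rw [abs_signedRpow hr]
    exact Real.rpow_le_rpow (abs_nonneg _) (hfL n t) hr.le
  have hFL : ∀ (n : ℕ) (a b : ℝ),
      |(∫ r in (0 : ℝ)..a, f n r) - (∫ r in (0 : ℝ)..b, f n r)| ≤ L * |a - b| := fun n =>
    abs_intervalIntegral_sub_le (hfc n) (hfL n)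
  have hFlip : ∀ n, LipschitzWith (Real.toNNReal L) fun t => ∫ r in (0 : ℝ)..t, f n r := fun n =>
    LipschitzWith.of_dist_le_mul fun a b => by
      rw [Real.coe_toNNReal _ hL0]
      exact hFL n a b
  have hFlim : ∀ t : ℝ, Tendsto (fun n => ∫ r in (0 : ℝ)..t, f n r) atTop
      (𝓝 (∫ r in (0 : ℝ)..t, φ r)) := fun t =>
    intervalIntegral.tendsto_integral_filter_of_dominated_convergence (fun _ => L)
      (Eventually.of_forall fun n => (hfc n).aestronglyMeasurable)
      (Eventually.of_forall fun n => Eventually.of_forall fun r _ => hfL n r)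
      _root_.intervalIntegrable_const (Eventually.of_forall fun r _ => hflim r)
  have hleft := tendsto_pairing_comp hp hu.memW0.memW hψ.memW hL0 hFL
    (fun n => (hFlip n).continuous) hFlim
  have hright := tendsto_setIntegral_comp_mul_mul hg hu.memW0.memW.memLp.1 hψ.memW.memLp.1 hM
    (H := fun n t => signedRpow (p - 1) (f n t))
    (fun n => (continuous_signedRpow hr).comp (hfc n)) hHb
    (fun t => ((continuous_signedRpow hr).tendsto _).comp (hflim t))
  refine le_of_tendsto_of_tendsto' hleft hright fun n => ?_
  obtain ⟨K, hK⟩ := hflip n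
  exact pairing_comp_le_of_lipschitz hp hu hψ hψ0 hM intervalIntegral.integral_same
    (intervalIntegral_sub_le_slope (hfc n) (hfm n)) (hFlip n) hK (hHb n)

end FracPLap

theorem mainTheorem3 (N : ℕ) (hN : 1 ≤ N) (s p : ℝ) (hp : 1 < p) (hs0 : 0 < s) (hs1 : s < 1)
    (Ω : Set (EuclideanSpace ℝ (Fin N))) (hΩo : IsOpen Ω) (hΩb : Bornology.IsBounded Ω)
    (g u : EuclideanSpace ℝ (Fin N) → ℝ)
    (hg_dual : FracPLap.MemDual s p Ω g) (hg_int : IntegrableOn g Ω volume)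
    (hu : FracPLap.IsWeakSolution s p Ω g u)
    (Ψ : ℝ → ℝ) (hΨ_C2 : ContDiff ℝ 2 Ψ) (hΨ_conv : ConvexOn ℝ Set.univ Ψ)
    (hΨ_lip : ∃ L : NNReal, LipschitzWith L Ψ) (hΨ_zero : Ψ 0 = 0)
    (hcase : (∃ M : ℝ, ∀ t : ℝ, |deriv (deriv Ψ) t| ≤ M) ∨
      (∀ᵐ x ∂(volume.restrict Ω), 0 ≤ g x) ∨ (∀ᵐ x ∂(volume.restrict Ω), g x ≤ 0)) :
    FracPLap.MemW0 s p Ω (fun x => Ψ (u x)) ∧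
    ∀ ψ : EuclideanSpace ℝ (Fin N) → ℝ, FracPLap.MemW0 s p Ω ψ →
      MemLp ψ ⊤ (volume.restrict Ω) → (∀ᵐ x : EuclideanSpace ℝ (Fin N), 0 ≤ ψ x) →
        Integrable (FracPLap.pairingIntegrand s p (fun x => Ψ (u x)) ψ) volume ∧
        IntegrableOn (fun x => |deriv Ψ (u x)| ^ (p - 2) * deriv Ψ (u x) * g x * ψ x) Ω volume ∧
        FracPLap.pairing s p (fun x => Ψ (u x)) ψ ≤
          ∫ x in Ω, |deriv Ψ (u x)| ^ (p - 2) * deriv Ψ (u x) * g x * ψ x := by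
  obtain ⟨L, hL⟩ := hΨ_lip
  have hr : 0 < p - 1 := sub_pos.2 hp
  have hdiff : Differentiable ℝ Ψ := hΨ_C2.differentiable (by norm_num)
  have hc : Continuous (deriv Ψ) := hΨ_C2.continuous_deriv (by norm_num)
  have hm : Monotone (deriv Ψ) := by
    rw [← monotoneOn_univ]
    exact hΨ_conv.monotoneOn_deriv fun x _ => hdiff x
  have hb : ∀ t, |deriv Ψ t| ≤ L := fun t => norm_deriv_le_of_lipschitz hL
  have hprim : ∀ t, ∫ r in (0 : ℝ)..t, deriv Ψ r = Ψ t := fun t => by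
    rw [intervalIntegral.integral_deriv_eq_sub (fun x _ => hdiff x) (hc.intervalIntegrable _ _),
      hΨ_zero, sub_zero]
  have hW := hu.memW0.comp_lipschitz (by linarith) hL hΨ_zero
  refine ⟨hW, fun ψ hψ hψb hψ0 => ⟨FracPLap.integrable_pairingIntegrand hp hW.memW hψ.memW, ?_⟩⟩
  obtain ⟨M, hM⟩ := FracPLap.ae_abs_le_of_memLp_top hΩo.measurableSet hψ hψb
  have hJ : ∀ t, |t| ^ (p - 2) * t = FracPLap.signedRpow (p - 1) t := fun t => by
    rw [FracPLap.signedRpow, show p - 1 - 1 = p - 2 by ring]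
  simp only [hJ]
  constructor
  · refine FracPLap.integrableOn_comp_mul_mul hg_int hu.memW0.memW.memLp.1 hψ.memW.memLp.1 hM
      (h := fun t => FracPLap.signedRpow (p - 1) (deriv Ψ t)) (C := (L : ℝ) ^ (p - 1))
      ((FracPLap.continuous_signedRpow hr).comp hc) fun t => ?_
    rw [FracPLap.abs_signedRpow hr]
    exact Real.rpow_le_rpow (abs_nonneg _) (hb t) hr.le
  · have := FracPLap.pairing_intervalIntegral_comp_le hp hg_int hu hψ hψ0 hM hc hm hb
    simpa only [hprim] using this
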